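/- Let $M=(S,\mathit{Act},P)$ be a Markov decision process: $S$ and $\mathit{Act}$ are finite sets, and $P\colon S\times\mathit{Act}\times S\to[0,1]$ is such that for all $s\in S$ and $a\in\mathit{Act}$ the sum $\sum_{t\in S}P(s,a,t)$ is either $1$ (the action $a$ is \emph{enabled} in $s$) or $0$; every state has at least one enabled action. An instance of the \emph{multi-agent stochastic shortest path problem} (MSSP) consists of such an MDP, a number $k\ge 1$ of agents, and, for every agent $i\in\{1,\dots,k\}$, an initial state $\iota_i\in S$ and a set $T_i\subseteq S$ of target states. A \emph{strategy} $\sigma$ of one agent consists of a non-empty, possibly infinite, set $\mathit{Mem}$ of memory states, an initial memory state $m_0\in \mathit{Mem}$, and a function that assigns to every $(s,m)\in S\times \mathit{Mem}$ a discrete probability distribution $\sigma(s,m)$ on $\mathit{Act}\times \mathit{Mem}$ such that $\sigma(s,m)(a,m')>0$ only if $a$ is enabled in $s$. Together with an initial state $\iota$ it induces the Markov chain on $S\times \mathit{Mem}$ that starts in $(\iota,m_0)$ and moves from $(s,m)$ to $(t,m')$ with probability $\sum_{a}\sigma(s,m)(a,m')\,P(s,a,t)$. An \emph{(autonomous strategy)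 profile} is a tuple $\pi=(\sigma_1,\dots,\sigma_k)$ of strategies; under $\pi$, the $k$ agents follow the chains induced by $\sigma_1,\dots,\sigma_k$ from $\iota_1,\dots,\iota_k$, simultaneously and independently. Let $\mathit{MHit}\in\mathbb{N}\cup\{\infty\}$ be the first time $n\ge 0$ at which some agent $i$ is in a state of $T_i$ ($\infty$ if there is no such time), and let $\mathbb{E}_\pi[\mathit{MHit}]\in[0,\infty]$ be its expected value under $\pi$. Let $\Pi$ be the class of all profiles and, for $n\ge1$, let $\Pi_n$ be the class of all profiles such that the memory set of every agent has at most $n$ elements. \textbf{Theorem.} For every MSSP instance, \begin{enumerate} \item there exists an optimal profile, i.e. a profile $\pi^*\in\Pi$ with $\mathbb{E}_{\pi^*}[\mathit{MHit}]=\inf_{\pi\in\Pi}\mathbb{E}_\pi[\mathit{MHit}]$; moreover, $\pi^*$ can be chosen such that the memory set of every agent is countable (finite or countably infinite); \item for every $n\ge 1$ there exists a $\Pi_n$-optimal profile, i.e. a profile $\pi^*\in\Pi_n$ with $\mathbb{E}_{\pi^*}[\mathit{MHit}]=\inf_{\pi\in\Pi_n}\mathbb{E}_\pi[\mathit{MHit}]$.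 \end{enumerate} -/

import Mathlib

open MeasureTheory ProbabilityTheory
open scoped ENNReal NNReal

universe u v w

noncomputable section

/-- A Markov decision process with finite sets `S` of states and `Act` of actions. For every state
`s` and action `a`, the numbers `P s a t` either sum up to `1` (the action `a` is enabled in `s`) or
to `0` (it is not). Every state has an enabled action. -/
structure MDP (S : Type u) (Act : Type v) [Fintype S] where
  P : S → Act → S → ℝ≥0
  sum_P : ∀ s a, ∑ t, P s a t = 0 ∨ ∑ t, P s a t = 1
  exists_enabled : ∀ s, ∃ a, ∑ t, P s a t = 1

namespace MDP

variable {S : Type u} {Act : Type v} [Fintype S] (M : MDP S Act)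

/-- The set of actions enabled in `s`. -/
def En (s : S) : Set Act := {a | ∑ t, M.P s a t = 1}

/-- The distribution of the next state when the enabled action `a` is performed in `s`. -/
def next (s : S) (a : Act) (ha : a ∈ M.En s) : PMF S :=
  PMF.ofFintype (fun t => (M.P s a t : ℝ≥0∞)) (by
    have h : ∑ t, M.P s a t = 1 := ha
    exact_mod_cast h)

/-- A (randomized) strategy of one agent: an arbitrary, possibly infinite, set `Mem` of memory
states with an initial memory state, and a map that assigns to every state and memory state a
distribution on pairs (action to be performed, new memory state), which chooses enabled actions
only. -/
structure Strategy where
  Mem : Type w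
  init : Mem
  choice : S → Mem → PMF (Act × Mem)
  enabled : ∀ s m, ∀ p ∈ (choice s m).support, p.1 ∈ M.En s

namespace Strategy

variable {M} (σ : Strategy.{u, v, w} M)

/-- Configurations: the current state together with the current memory state. -/
structure Config where
  state : S
  mem : σ.Mem

/-- Configurations carry the discrete σ-algebra. -/
instance : MeasurableSpace σ.Config := ⊤

instance : DiscreteMeasurableSpace σ.Config := ⟨fun _ => trivial⟩

/-- One step of the Markov chain on configurations induced by `σ`: from `(s, m)`, first the pair
`(a, m')` is chosen by `σ`, then the next state `t` is chosen by the MDP, and the new configuration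
is `(t, m')`. -/
def step (c : σ.Config) : PMF σ.Config :=
  (σ.choice c.state c.mem).bindOnSupport fun p hp =>
    (M.next c.state p.1 (σ.enabled c.state c.mem p hp)).map fun t => ⟨t, p.2⟩

/-- The transition kernel of the Markov chain on configurations induced by `σ`. -/
def kernel : Kernel σ.Config σ.Config where
  toFun c := (σ.step c).toMeasure
  measurable' := Measurable.of_discrete

instance : IsMarkovKernel σ.kernel :=
  ⟨fun c => inferInstanceAs (IsProbabilityMeasure (σ.step c).toMeasure)⟩

/-- The law, on infinite sequences of configurations, of the Markov chain induced by `σ` and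
started in the state `s` with the initial memory state. -/
def law (s : S) : Measure (ℕ → σ.Config) :=
  Kernel.traj (X := fun _ => σ.Config)
    (fun n => σ.kernel.comap (fun h => h ⟨n, Finset.mem_Iic.2 le_rfl⟩)
      (measurable_pi_apply (_ : Finset.Iic n))) 0
    (fun _ => ⟨s, σ.init⟩)

instance (s : S) : IsProbabilityMeasure (σ.law s) := by
  unfold law
  exact IsMarkovKernel.isProbabilityMeasure _

/-- The first time at which the trajectory `ω` visits a state of `T`
(and `∞` if there is no such time). -/
def hit (T : Set S) (ω : ℕ → σ.Config) : ℝ≥0∞ :=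
  ⨅ (n : ℕ) (_ : (ω n).state ∈ T), (n : ℝ≥0∞)

end Strategy

end MDP

/-- An instance of the multi-agent stochastic shortest path problem: an MDP, a number `k ≥ 1` of
agents, and an initial state and a set of target states for every agent. -/
structure MSSP (S : Type u) (Act : Type v) [Fintype S] where
  M : MDP S Act
  k : ℕ
  one_le_k : 1 ≤ k
  init : Fin k → S
  target : Fin k → Set S

namespace MSSP

variable {S : Type u} {Act : Type v} [Fintype S] (I : MSSP S Act)

/-- An autonomous strategy profile: one strategy for every agent. -/
abbrev Profile : Type (max u v (w + 1)) := Fin I.k → MDP.Strategy.{u, v, w} I.M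

variable {I}

/-- The joint law of the trajectories of all agents, which move independently. -/
def law (π : Profile.{u, v, w} I) : Measure (∀ i, ℕ → (π i).Config) :=
  Measure.pi fun i => (π i).law (I.init i)

/-- The first time at which some agent visits one of its own target states. -/
def mHit (π : Profile.{u, v, w} I) (ω : ∀ i, ℕ → (π i).Config) : ℝ≥0∞ :=
  ⨅ i, (π i).hit (I.target i) (ω i)

/-- The expected value of `mHit`, an element of `[0, ∞]`. -/
def expMHit (π : Profile.{u, v, w} I) : ℝ≥0∞ :=
  ∫⁻ ω, mHit π ω ∂(law π)

/-- `π` minimizes the expected value of `mHit` among all autonomous strategy profiles. -/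
def IsOptimal (π : Profile.{u, v, w} I) : Prop :=
  expMHit π = ⨅ π' : Profile.{u, v, w} I, expMHit π'

variable (I)

/-- The class of all autonomous strategy profiles where every agent has at most `n` memory
states. -/
def memBounded (n : ℕ) : Set (Profile.{u, v, w} I) :=
  {π | ∀ i, ENat.card (π i).Mem ≤ n}

variable {I}

/-- `π` has at most `n` memory states per agent, and minimizes the expected value of `mHit` among
all such autonomous strategy profiles. -/
def IsMemOptimal (n : ℕ) (π : Profile.{u, v, w} I) : Prop :=
  π ∈ memBounded.{u, v, w} I n ∧ expMHit π = ⨅ π' ∈ memBounded.{u, v, w} I n, expMHit π'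

end MSSP

end

/-!
The time `MHit` exceeds `n` iff every agent avoids its own targets up to time `n`. The agents are
independent, so the expectation of `MHit` is `∑ n, ∏ i, u i n`, where `u i n` is the survival
probability of agent `i`, i.e. the probability that it avoids its targets at the times `0, …, n`
(`MSSP.expMHit_eq_tsum`). This expression is lower semicontinuous in the sequences `u i`, so it
attains its minimum over every class of profiles for which the survival sequences of each agent
form a compact set (`MSSP.exists_expMHit_minimal`). It remains to find such classes.

For arbitrary strategies, the survival sequence depends only on the probabilities `x n t a` that the
agent avoids its targets up to time `n`, is in `t` at time `n` and performs `a` there. They satisfy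
the linear flow equations defining `MDP.flows`, which cut out a compact set. Conversely, every flow
comes from a strategy which uses the time as its memory state, and which chooses `a` in `t` at time
`n` with the conditional probability `x n t a / ∑ b, x n t b` (`MDP.Strategy.expAvoid_markov`).
Hence strategies with countable memory yield all survival sequences, and these form a compact set
(`MDP.isCompact_survival_countable`).

For strategies with at most `n` memory states, a memory set with exactly `n` elements suffices
(`MDP.Strategy.exists_ofChoice`). On it, the choice functions form a compact set, and the
probability of avoiding the targets up to a fixed time is a polynomial in the choice probabilities,
hence continuous (`MDP.isCompact_survival_ofChoice`).
-/

/-! ### Sums against probability mass functions -/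

theorem PMF.tsum_map_mul {α : Type*} {β : Type*} (p : PMF α) (f : α → β) (g : β → ℝ≥0∞) :
    ∑' b, p.map f b * g b = ∑' a, p a * g (f a) := by
  classical
  simp_rw [PMF.map_apply, ← ENNReal.tsum_mul_right]
  rw [ENNReal.tsum_comm]
  refine tsum_congr fun a => ?_
  rw [tsum_eq_single (f a)]
  · simp
  · intro b hb
    simp [hb]

theorem PMF.lintegral_toMeasure {α : Type*} [MeasurableSpace α] [DiscreteMeasurableSpace α]
    (p : PMF α) (g : α → ℝ≥0∞) : ∫⁻ a, g a ∂p.toMeasure = ∑' a, p a * g a := by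
  have h : p.toMeasure = Measure.sum fun a => p a • Measure.dirac a := by
    ext s hs
    rw [PMF.toMeasure_apply_eq_tsum, Measure.sum_apply _ hs]
    refine tsum_congr fun a => ?_
    by_cases ha : a ∈ s <;> simp [ha]
  rw [h, lintegral_sum_measure]
  simp

namespace MDP.Strategy

variable {S : Type u} {Act : Type v} [Fintype S] {M : MDP S Act} (σ : Strategy.{u, v, w} M)

/-! ### The chain killed in the target states -/

/-- The sub-Markov operator of the chain on configurations that is killed when it enters a state
of `T`: the value at `c` is the expectation of `g` after one step from `c`, restricted to the event
that this step does not end in `T`. -/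
noncomputable def avoid (T : Set S) (g : σ.Config → ℝ≥0∞) (c : σ.Config) : ℝ≥0∞ :=
  ∑' p : Act × σ.Mem, σ.choice c.state c.mem p *
    ∑ t, M.P c.state p.1 t * Tᶜ.indicator (fun t => g ⟨t, p.2⟩) t

/-- The expectation of `g` at time `n`, restricted to the event that none of the states at the times
`0, …, n` is in `T`, for the chain started in `s`. -/
noncomputable def expAvoid (s : S) (T : Set S) (n : ℕ) (g : σ.Config → ℝ≥0∞) : ℝ≥0∞ :=
  Tᶜ.indicator (fun s => (σ.avoid T)^[n] g ⟨s, σ.init⟩) s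

/-- The event that none of the states at the times `0, …, n` is in `T`. -/
def avoidSet (T : Set S) (n : ℕ) : Set (ℕ → σ.Config) := {ω | ∀ j ≤ n, (ω j).state ∉ T}

/-- The probability that none of the states at the times `0, …, n` is in `T`, that is, that `T` is
hit after time `n`. -/
noncomputable def survival (s : S) (T : Set S) (n : ℕ) : ℝ≥0∞ := σ.expAvoid s T n 1

theorem tsum_step_mul (c : σ.Config) (g : σ.Config → ℝ≥0∞) :
    ∑' d, σ.step c d * g d = ∑' p : Act × σ.Mem, σ.choice c.state c.mem p *
      ∑ t, M.P c.state p.1 t * g ⟨t, p.2⟩ := by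
  simp_rw [step, PMF.bindOnSupport_apply, ← ENNReal.tsum_mul_right]
  rw [ENNReal.tsum_comm]
  refine tsum_congr fun p => ?_
  simp_rw [mul_assoc, ENNReal.tsum_mul_left]
  by_cases h : σ.choice c.state c.mem p = 0
  · simp [h]
  · simp only [h, ↓reduceDIte]
    rw [PMF.tsum_map_mul, tsum_fintype]
    rfl

theorem avoid_eq_lintegral (T : Set S) (g : σ.Config → ℝ≥0∞) (c : σ.Config) :
    σ.avoid T g c = ∫⁻ d, {d : σ.Config | d.state ∉ T}.indicator g d ∂σ.kernel c := by
  rw [show σ.kernel c = (σ.step c).toMeasure from rfl, PMF.lintegral_toMeasure, tsum_step_mul]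
  rfl

theorem measurableSet_avoidSet (T : Set S) (n : ℕ) : MeasurableSet (σ.avoidSet T n) := by
  have : σ.avoidSet T n = ⋂ j, ⋂ (_ : j ≤ n), (fun ω => ω j) ⁻¹' {c | c.state ∉ T} := by
    ext ω
    simp [avoidSet]
  rw [this]
  exact MeasurableSet.iInter fun j => MeasurableSet.iInter fun _ =>
    measurable_pi_apply j (MeasurableSet.of_discrete (s := {c : σ.Config | c.state ∉ T}))

/-- The Markov property at time `n`, for the chain killed in `T`. -/
theorem lintegral_avoidSet_succ (s : S) (T : Set S) (n : ℕ) (g : σ.Config → ℝ≥0∞) :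
    ∫⁻ ω in σ.avoidSet T (n + 1), g (ω (n + 1)) ∂σ.law s =
      ∫⁻ ω in σ.avoidSet T n, σ.avoid T g (ω n) ∂σ.law s := by
  let G : σ.Config → ℝ≥0∞ := {d : σ.Config | d.state ∉ T}.indicator g
  have hG : Measurable G := Measurable.of_discrete
  let A : Set ((i : Finset.Iic n) → σ.Config) := {h | ∀ i, (h i).state ∉ T}
  have hA : MeasurableSet A := by
    have : A = ⋂ i, (fun h => h i) ⁻¹' {c | c.state ∉ T} := by
      ext h
      simp [A]
    rw [this]
    exact MeasurableSet.iInter fun i =>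
      measurable_pi_apply i (MeasurableSet.of_discrete (s := {c : σ.Config | c.state ∉ T}))
  have hmem (ω : ℕ → σ.Config) : Preorder.frestrictLe n ω ∈ A ↔ ω ∈ σ.avoidSet T n := by
    simp [A, avoidSet, Preorder.frestrictLe]
  let F : ((i : Finset.Iic n) → σ.Config) × σ.Config → ℝ≥0∞ :=
    fun q => A.indicator (fun _ => G q.2) q.1
  have hF : Measurable F := by
    have : F = (A ×ˢ Set.univ).indicator fun q => G q.2 := by
      ext q
      by_cases hq : q.1 ∈ A <;> simp [F, hq]
    rw [this]
    exact (hG.comp measurable_snd).indicator (hA.prod MeasurableSet.univ)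
  have key := Kernel.partialTraj_compProd_eq_map_traj (X := fun _ => σ.Config)
    (κ := fun n => σ.kernel.comap (fun h : (i : Finset.Iic n) → σ.Config =>
      h ⟨n, Finset.mem_Iic.2 le_rfl⟩) (measurable_pi_apply (_ : Finset.Iic n)))
    (Nat.zero_le n) (x₀ := fun _ => ⟨s, σ.init⟩)
  have h1 : ∫⁻ ω, F (Preorder.frestrictLe n ω, ω (n + 1)) ∂σ.law s =
      ∫⁻ ω in σ.avoidSet T n, σ.avoid T g (ω n) ∂σ.law s := by
    have e1 := congrArg (fun μ => ∫⁻ q, F q ∂μ) key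
    rw [lintegral_map hF (by fun_prop), Measure.lintegral_compProd hF] at e1
    rw [law, ← e1, ← Kernel.traj_map_frestrictLe_apply, lintegral_map hF.lintegral_kernel_prod_right'
      (by fun_prop), ← lintegral_indicator (σ.measurableSet_avoidSet T n)]
    refine lintegral_congr fun ω => ?_
    by_cases hω : ω ∈ σ.avoidSet T n
    · have := (hmem ω).2 hω
      simp only [F, this, hω, Set.indicator_of_mem, avoid_eq_lintegral]
      rfl
    · have := (hmem ω).not.2 hω
      simp [F, this, hω]
  rw [← h1, ← lintegral_indicator (σ.measurableSet_avoidSet T (n + 1))]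
  refine lintegral_congr fun ω => ?_
  have hsucc : ω ∈ σ.avoidSet T (n + 1) ↔ ω ∈ σ.avoidSet T n ∧ (ω (n + 1)).state ∉ T := by
    simp only [avoidSet, Set.mem_ofPred_eq, Nat.le_succ_iff]
    grind
  by_cases hω : ω ∈ σ.avoidSet T n
  · have := (hmem ω).2 hω
    by_cases h' : (ω (n + 1)).state ∈ T <;> simp [F, G, hsucc, hω, h', this]
  · have := (hmem ω).not.2 hω
    simp [F, hsucc, hω, this]

theorem law_map_zero (s : S) : (σ.law s).map (fun ω => ω 0) = Measure.dirac ⟨s, σ.init⟩ := by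
  rw [law, show (fun ω : ℕ → σ.Config => ω 0) =
    (fun h : (i : Finset.Iic 0) → σ.Config => h ⟨0, Finset.mem_Iic.2 le_rfl⟩) ∘
      Preorder.frestrictLe 0 from rfl, ← Measure.map_map (by fun_prop) (by fun_prop),
    Kernel.traj_map_frestrictLe_apply, Kernel.partialTraj_self, Kernel.id_apply,
    Measure.map_dirac' (by fun_prop)]

theorem lintegral_avoidSet (s : S) (T : Set S) (n : ℕ) (g : σ.Config → ℝ≥0∞) :
    ∫⁻ ω in σ.avoidSet T n, g (ω n) ∂σ.law s = σ.expAvoid s T n g := by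
  induction n generalizing g with
  | zero =>
    have hg : Measurable ({d : σ.Config | d.state ∉ T}.indicator g) := Measurable.of_discrete
    have h := congrArg (fun μ => ∫⁻ c, {d : σ.Config | d.state ∉ T}.indicator g c ∂μ)
      (σ.law_map_zero s)
    rw [lintegral_map hg (measurable_pi_apply 0), lintegral_dirac' _ hg] at h
    rw [← lintegral_indicator (σ.measurableSet_avoidSet T 0)]
    refine Eq.trans (lintegral_congr fun ω => ?_) (h.trans ?_)
    · by_cases hω : (ω 0).state ∈ T <;> simp [avoidSet, hω]
    · by_cases hs : s ∈ T <;> simp [expAvoid, hs]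
  | succ n ih => rw [lintegral_avoidSet_succ, ih]; rfl

theorem law_avoidSet (s : S) (T : Set S) (n : ℕ) :
    σ.law s (σ.avoidSet T n) = σ.survival s T n := by
  rw [survival, ← lintegral_avoidSet]
  simp

theorem survival_le_one (s : S) (T : Set S) (n : ℕ) : σ.survival s T n ≤ 1 :=
  law_avoidSet σ s T n ▸ prob_le_one

end MDP.Strategy

namespace MSSP

variable {S : Type u} {Act : Type v} [Fintype S] {I : MSSP S Act}

/-! ### The expected hitting time as a sum of products -/

theorem mHit_eq_tsum (π : Profile.{u, v, w} I) (ω : ∀ i, ℕ → (π i).Config) :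
    mHit π ω = ∑' n, (Set.univ.pi fun i => (π i).avoidSet (I.target i) n).indicator 1 ω := by
  classical
  by_cases h : ∃ n, ∃ i, (ω i n).state ∈ I.target i
  · have hval : mHit π ω = (Nat.find h : ℝ≥0∞) := by
      refine le_antisymm ?_ ?_
      · obtain ⟨i, hi⟩ := Nat.find_spec h
        exact (iInf_le _ i).trans (iInf₂_le (Nat.find h) hi)
      · refine le_iInf fun i => le_iInf₂ fun n hn => ?_
        exact_mod_cast Nat.find_min' h ⟨i, hn⟩
    have hmem (n : ℕ) : ω ∈ (Set.univ.pi fun i => (π i).avoidSet (I.target i) n) ↔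
        n ∈ Finset.range (Nat.find h) := by
      simp only [Set.mem_univ_pi, MDP.Strategy.avoidSet, Set.mem_ofPred_eq, Finset.mem_range,
        Nat.lt_find_iff, not_exists]
      exact forall_comm.trans (forall_congr' fun _ => forall_comm)
    rw [hval, tsum_eq_sum (s := Finset.range (Nat.find h))]
    · rw [Finset.sum_congr rfl fun n hn => Set.indicator_of_mem ((hmem n).2 hn) _]
      simp
    · exact fun n hn => Set.indicator_of_notMem ((hmem n).not.2 hn) _
  · push Not at h
    have hval : mHit π ω = ⊤ := by
      simp [mHit, MDP.Strategy.hit, h]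
    have hmem (n : ℕ) : ω ∈ (Set.univ.pi fun i => (π i).avoidSet (I.target i) n) :=
      fun i _ j _ => h j i
    simp [hval, hmem]

/-- The agents are independent, so `MHit` exceeds `n` with the product of the probabilities that
the individual agents avoid their targets up to time `n`. -/
theorem expMHit_eq_tsum (π : Profile.{u, v, w} I) :
    expMHit π = ∑' n, ∏ i, (π i).survival (I.init i) (I.target i) n := by
  have hm (n : ℕ) : MeasurableSet (Set.univ.pi fun i => (π i).avoidSet (I.target i) n) :=
    MeasurableSet.univ_pi fun i => (π i).measurableSet_avoidSet _ n
  simp_rw [expMHit, mHit_eq_tsum]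
  rw [lintegral_tsum fun n => (measurable_one.indicator (hm n)).aemeasurable]
  refine tsum_congr fun n => ?_
  rw [lintegral_indicator_one (hm n), law, Measure.pi_pi]
  simp_rw [MDP.Strategy.law_avoidSet]

/-! ### Compactness yields optimal profiles -/

/-- A sum of products is lower semicontinuous in its factors, hence it attains its minimum over
classes of strategies whose survival probabilities form compact sets of sequences. -/
theorem exists_expMHit_minimal (C : Fin I.k → Set (MDP.Strategy.{u, v, w} I.M))
    (hne : ∀ i, (C i).Nonempty)
    (hC : ∀ i, IsCompact ((fun σ => σ.survival (I.init i) (I.target i)) '' C i)) :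
    ∃ π : Profile.{u, v, w} I, (∀ i, π i ∈ C i) ∧
      ∀ π' : Profile.{u, v, w} I, (∀ i, π' i ∈ C i) → expMHit π ≤ expMHit π' := by
  let U : Fin I.k → Set (ℕ → ℝ≥0∞) :=
    fun i => (fun σ : MDP.Strategy.{u, v, w} I.M => σ.survival (I.init i) (I.target i)) '' C i
  have hcont (n : ℕ) : ContinuousOn (fun f : Fin I.k → ℕ → ℝ≥0∞ => ∏ i, f i n)
      (Set.univ.pi U) := by
    intro f hf
    refine ENNReal.tendsto_finsetProd_of_ne_top _ (fun i _ => ?_) fun i _ => ?_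
    · exact (((continuous_apply n).comp (continuous_apply i)).tendsto f).mono_left nhdsWithin_le_nhds
    · obtain ⟨σ, _, hσ⟩ := hf i (Set.mem_univ i)
      rw [← hσ]
      exact ne_top_of_le_ne_top ENNReal.one_ne_top (σ.survival_le_one _ _ n)
  obtain ⟨f, hf, hmin⟩ := LowerSemicontinuousOn.exists_isMinOn
    (Set.univ_pi_nonempty_iff.2 fun i => (hne i).image _) (isCompact_univ_pi hC)
    (lowerSemicontinuousOn_tsum fun n => (hcont n).lowerSemicontinuousOn)
  choose π hπ hfπ using fun i => hf i (Set.mem_univ i)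
  refine ⟨π, hπ, fun π' hπ' => ?_⟩
  have := hmin (a := fun i => (π' i).survival (I.init i) (I.target i))
    fun i _ => ⟨π' i, hπ' i, rfl⟩
  simp only [Set.mem_ofPred_eq, ← hfπ] at this
  simpa only [expMHit_eq_tsum] using this

end MSSP

namespace MDP

variable {S : Type u} {Act : Type v} [Fintype S] {M : MDP S Act}

namespace Strategy

variable (σ : Strategy.{u, v, w} M)

theorem expAvoid_sum {ι : Type*} (F : Finset ι) (s : S) (T : Set S) (n : ℕ)
    (g : ι → σ.Config → ℝ≥0∞) :
    σ.expAvoid s T n (fun c => ∑ i ∈ F, g i c) = ∑ i ∈ F, σ.expAvoid s T n (g i) := by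
  simp_rw [← lintegral_avoidSet]
  exact lintegral_finsetSum _ fun i _ =>
    (Measurable.of_discrete (f := g i)).comp (measurable_pi_apply n)

theorem expAvoid_mul_const (s : S) (T : Set S) (n : ℕ) (g : σ.Config → ℝ≥0∞) (r : ℝ≥0∞) :
    σ.expAvoid s T n (fun c => g c * r) = σ.expAvoid s T n g * r := by
  simp_rw [← lintegral_avoidSet]
  exact lintegral_mul_const _ ((Measurable.of_discrete (f := g)).comp (measurable_pi_apply n))

end Strategy

/-! ### Occupation flows -/

variable [Fintype Act]

variable (M) in
/-- The flows of the MDP that start with a unit mass in `s` and lose all mass that enters `T`.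
The number `x n t a` stands for the probability to be in `t` and to perform `a` at time `n` without
a visit to `T` up to that time. -/
def flows (s : S) (T : Set S) : Set (ℕ → S → Act → ℝ≥0∞) :=
  open Classical in
  {x | (∀ n t a, a ∉ M.En t → x n t a = 0) ∧
    (∀ t, ∑ a, x 0 t a = Tᶜ.indicator (fun t => if s = t then 1 else 0) t) ∧
    ∀ n t, ∑ a, x (n + 1) t a = Tᶜ.indicator (fun t => ∑ t', ∑ a, x n t' a * M.P t' a t) t}

theorem isCompact_flows (s : S) (T : Set S) : IsCompact (M.flows s T) := by
  have hx (n : ℕ) (t : S) (a : Act) : Continuous fun x : ℕ → S → Act → ℝ≥0∞ => x n t a := by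
    fun_prop
  refine IsClosed.isCompact ?_
  simp only [flows, Set.ofPred_and, Set.ofPred_forall]
  refine .inter ?_ (.inter ?_ ?_)
  · exact isClosed_iInter fun n => isClosed_iInter fun t => isClosed_iInter fun a =>
      isClosed_iInter fun _ => isClosed_eq (hx n t a) continuous_const
  · exact isClosed_iInter fun t =>
      isClosed_eq (continuous_finsetSum _ fun a _ => hx 0 t a) continuous_const
  · refine isClosed_iInter fun n => isClosed_iInter fun t =>
      isClosed_eq (continuous_finsetSum _ fun a _ => hx (n + 1) t a) ?_
    by_cases ht : t ∈ T
    · simpa [ht] using continuous_const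
    · simp only [Set.mem_compl_iff, ht, not_false_eq_true, Set.indicator_of_mem]
      exact continuous_finsetSum _ fun t' _ => continuous_finsetSum _ fun a _ =>
        ENNReal.continuous_mul_const ENNReal.coe_ne_top |>.comp (hx n t' a)

namespace Strategy

variable (σ : Strategy.{u, v, w} M)

/-- The probability that `σ` performs `a` in `t` at time `n` without a visit to `T` up to that
time. -/
noncomputable def occupation (s : S) (T : Set S) (n : ℕ) (t : S) (a : Act) : ℝ≥0∞ :=
  open Classical in
  σ.expAvoid s T n fun c => if c.state = t then ∑' m, σ.choice c.state c.mem (a, m) else 0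

theorem sum_choice (s : S) (m : σ.Mem) : ∑ a, ∑' m', σ.choice s m (a, m') = 1 := by
  rw [← tsum_fintype (L := .unconditional _), ← ENNReal.tsum_prod]
  exact (σ.choice s m).tsum_coe

open Classical in
theorem sum_occupation (s : S) (T : Set S) (n : ℕ) (t : S) :
    ∑ a, σ.occupation s T n t a = σ.expAvoid s T n fun c => if c.state = t then 1 else 0 := by
  simp_rw [occupation, ← expAvoid_sum]
  congr 1 with c
  by_cases h : c.state = t <;> simp [h, sum_choice]

theorem survival_eq_sum_occupation (s : S) (T : Set S) (n : ℕ) :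
    σ.survival s T n = ∑ t, ∑ a, σ.occupation s T n t a := by
  classical
  simp_rw [sum_occupation, ← expAvoid_sum]
  simp [survival, Pi.one_def]

theorem occupation_mem_flows (s : S) (T : Set S) : σ.occupation s T ∈ M.flows s T := by
  classical
  refine ⟨fun n t a ha => ?_, fun t => ?_, fun n t => ?_⟩
  · have h0 (c : σ.Config) : (if c.state = t then ∑' m, σ.choice c.state c.mem (a, m) else 0) =
        (0 : ℝ≥0∞) := by
      split_ifs with hc
      · refine ENNReal.tsum_eq_zero.2 fun m => ?_
        by_contra hne
        exact ha (hc ▸ σ.enabled _ _ _ ((PMF.mem_support_iff _ _).2 hne))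
      · rfl
    simp only [occupation, h0, ← lintegral_avoidSet, lintegral_zero]
  · rw [sum_occupation]
    by_cases hs : s ∈ T
    · by_cases ht : t ∈ T
      · simp [expAvoid, hs, ht]
      · have : s ≠ t := fun h => ht (h ▸ hs)
        simp [expAvoid, hs, ht, this]
    · by_cases ht : t ∈ T
      · have : s ≠ t := fun h => hs (h ▸ ht)
        simp [expAvoid, ht, this]
      · simp [expAvoid, hs, ht]
  · rw [sum_occupation]
    have hexp : σ.expAvoid s T (n + 1) (fun c => if c.state = t then 1 else 0) =
      σ.expAvoid s T n (σ.avoid T fun c => if c.state = t then 1 else 0) := rfl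
    rw [hexp]
    by_cases ht : t ∈ T
    · have h0 : (σ.avoid T fun c => if c.state = t then 1 else 0) = fun _ => 0 := by
        ext c
        have (p : Act × σ.Mem) (t' : S) : (M.P c.state p.1 t' : ℝ≥0∞) *
            Tᶜ.indicator (fun t' => if t' = t then 1 else 0) t' = 0 := by
          by_cases h : t' = t
          · simp [h, ht]
          · by_cases h' : t' ∈ T <;> simp [h, h']
        simp [avoid, this]
      simp only [h0, ← lintegral_avoidSet, lintegral_zero]
      simp [ht]
    · simp only [Set.mem_compl_iff, ht, not_false_eq_true, Set.indicator_of_mem, occupation,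
        ← expAvoid_mul_const, ← expAvoid_sum]
      congr 1 with c
      have (p : Act × σ.Mem) : ∑ t', (M.P c.state p.1 t' : ℝ≥0∞) *
          Tᶜ.indicator (fun t' => if t' = t then 1 else 0) t' = M.P c.state p.1 t := by
        rw [Finset.sum_eq_single t]
        · simp [ht]
        · intro t' _ h
          by_cases h' : t' ∈ T <;> simp [h, h']
        · simp
      simp only [avoid, this]
      rw [Finset.sum_eq_single c.state]
      · refine (ENNReal.tsum_prod (f := fun a m =>
          σ.choice c.state c.mem (a, m) * (M.P c.state a t : ℝ≥0∞))).trans ?_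
        simp [ENNReal.tsum_mul_right, tsum_fintype]
      · intro t' _ h
        simp [h.symm]
      · simp

/-! ### Strategies that remember the time only -/

/-- The strategy whose memory state is the current time, and which chooses its action according to
the current state and time. -/
noncomputable def markov (α : ℕ → S → PMF Act) (hα : ∀ n t, ∀ a ∈ (α n t).support, a ∈ M.En t) :
    Strategy.{u, v, w} M where
  Mem := ULift.{w} ℕ
  init := ⟨0⟩
  choice s m := (α m.down s).map fun a => (a, ⟨m.down + 1⟩)
  enabled s m p hp := by
    obtain ⟨a, ha, rfl⟩ := (PMF.mem_support_map_iff _ _ _).1 hp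
    exact hα _ _ a ha

/-- If the actions are chosen with the conditional probabilities given by a flow, then the law of
the state at time `n`, on the event that `T` has not been visited, is the one given by the flow. -/
theorem expAvoid_markov {s : S} {T : Set S} {x : ℕ → S → Act → ℝ≥0∞} (hx : x ∈ M.flows s T)
    (α : ℕ → S → PMF Act) (hα : ∀ n t, ∀ a ∈ (α n t).support, a ∈ M.En t)
    (hxα : ∀ n t a, x n t a = (∑ b, x n t b) * α n t a) (n : ℕ)
    (g : (markov.{u, v, w} α hα).Config → ℝ≥0∞) :
    (markov.{u, v, w} α hα).expAvoid s T n g = ∑ t, (∑ a, x n t a) * g ⟨t, ⟨n⟩⟩ := by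
  classical
  induction n generalizing g with
  | zero =>
    simp_rw [hx.2.1]
    rw [Finset.sum_eq_single s]
    · by_cases hs : s ∈ T
      · simp [expAvoid, hs]
      · simp only [expAvoid, hs, Set.mem_compl_iff, not_false_eq_true, Set.indicator_of_mem,
          if_true, one_mul]
        rfl
    · intro t _ ht
      by_cases h : t ∈ T <;> simp [h, ht.symm]
    · simp
  | succ n ih =>
    have havoid (t : S) : (markov.{u, v, w} α hα).avoid T g ⟨t, ⟨n⟩⟩ =
        ∑ a, α n t a * ∑ t', M.P t a t' * Tᶜ.indicator (fun t' => g ⟨t', ⟨n + 1⟩⟩) t' := by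
      rw [avoid, ← tsum_fintype (L := .unconditional _)]
      exact PMF.tsum_map_mul (α n t) (fun a => (a, (⟨n + 1⟩ : ULift.{w} ℕ))) fun p =>
        ∑ t', M.P t p.1 t' * Tᶜ.indicator (fun t' => g ⟨t', p.2⟩) t'
    have hexp : (markov.{u, v, w} α hα).expAvoid s T (n + 1) g =
      (markov.{u, v, w} α hα).expAvoid s T n ((markov.{u, v, w} α hα).avoid T g) := rfl
    rw [hexp, ih]
    simp_rw [havoid, Finset.mul_sum, ← mul_assoc, ← hxα, hx.2.2]
    have hr (t' : S) : Tᶜ.indicator (fun t' => ∑ t, ∑ a, x n t a * M.P t a t') t' *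
        g ⟨t', ⟨n + 1⟩⟩ = ∑ t, ∑ a, x n t a * M.P t a t' *
          Tᶜ.indicator (fun t' => g ⟨t', ⟨n + 1⟩⟩) t' := by
      by_cases h : t' ∈ T <;> simp [h, Finset.sum_mul]
    rw [Finset.sum_congr rfl fun t' _ => hr t', Finset.sum_comm]
    refine (Finset.sum_congr rfl fun t _ => Finset.sum_comm).trans ?_
    rw [Finset.sum_comm]
    exact Finset.sum_congr rfl fun _ _ => Finset.sum_comm

end Strategy

theorem flows_ne_top {s : S} {T : Set S} {x : ℕ → S → Act → ℝ≥0∞} (hx : x ∈ M.flows s T)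
    (n : ℕ) (t : S) : ∑ a, x n t a ≠ ⊤ := by
  induction n generalizing t with
  | zero =>
    rw [hx.2.1]
    by_cases ht : t ∈ T
    · simp [ht]
    · by_cases hs : s = t <;> simp [ht, hs]
  | succ n ih =>
    rw [hx.2.2]
    by_cases ht : t ∈ T
    · simp [ht]
    · simp only [Set.mem_compl_iff, ht, not_false_eq_true, Set.indicator_of_mem]
      refine ENNReal.sum_ne_top.2 fun t' _ => ENNReal.sum_ne_top.2 fun a _ =>
        ENNReal.mul_ne_top ?_ ENNReal.coe_ne_top
      exact ENNReal.sum_ne_top.1 (ih t') a (Finset.mem_univ a)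

/-- Every flow is realized by a strategy with countable memory. -/
theorem exists_countable_survival_eq {s : S} {T : Set S} {x : ℕ → S → Act → ℝ≥0∞}
    (hx : x ∈ M.flows s T) :
    ∃ σ : Strategy.{u, v, w} M, Countable σ.Mem ∧ ∀ n, σ.survival s T n = ∑ t, ∑ a, x n t a := by
  have hex (n : ℕ) (t : S) : ∃ p : PMF Act, (∀ a ∈ p.support, a ∈ M.En t) ∧
      ∀ a, x n t a = (∑ b, x n t b) * p a := by
    by_cases h0 : ∑ b, x n t b = 0
    -- Where the flow vanishes there is no conditional probability, and any enabled action will do.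
    · obtain ⟨a₀, ha₀⟩ := M.exists_enabled t
      refine ⟨PMF.pure a₀, fun a ha => ?_, fun a => ?_⟩
      · rw [PMF.mem_support_pure_iff] at ha
        exact ha ▸ ha₀
      · rw [h0, zero_mul]
        exact Finset.sum_eq_zero_iff.1 h0 a (Finset.mem_univ a)
    · have htop := flows_ne_top hx n t
      refine ⟨PMF.normalize (x n t) (by rwa [tsum_fintype]) (by rwa [tsum_fintype]),
        fun a ha => ?_, fun a => ?_⟩
      · rw [PMF.mem_support_normalize_iff] at ha
        by_contra hne
        exact ha (hx.1 n t a hne)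
      · rw [PMF.normalize_apply, tsum_fintype, mul_left_comm, ENNReal.mul_inv_cancel h0 htop,
          mul_one]
  choose α hα hxα using hex
  refine ⟨Strategy.markov α hα, inferInstanceAs (Countable (ULift ℕ)), fun n => ?_⟩
  rw [Strategy.survival, Strategy.expAvoid_markov hx α hα hxα]
  simp

/-- The survival probabilities of the strategies with countable memory are those of the flows. -/
theorem isCompact_survival_countable (s : S) (T : Set S) :
    IsCompact ((fun σ : Strategy.{u, v, w} M => σ.survival s T) '' {σ | Countable σ.Mem}) := by
  have hcont : Continuous fun (x : ℕ → S → Act → ℝ≥0∞) n => ∑ t, ∑ a, x n t a := by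
    fun_prop
  convert (isCompact_flows (M := M) s T).image hcont using 1
  ext f
  constructor
  · rintro ⟨σ, -, rfl⟩
    exact ⟨σ.occupation s T, σ.occupation_mem_flows s T,
      funext fun n => (σ.survival_eq_sum_occupation s T n).symm⟩
  · rintro ⟨x, hx, rfl⟩
    obtain ⟨σ, hσ, h⟩ := exists_countable_survival_eq.{u, v, w} hx
    exact ⟨σ, hσ, funext h⟩

/-- Strategies with countable memory perform as well as arbitrary ones. -/
theorem Strategy.exists_countable (σ : Strategy.{u, v, w} M) (s : S) (T : Set S) :
    ∃ τ : Strategy.{u, v, w} M, Countable τ.Mem ∧ τ.survival s T = σ.survival s T := by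
  obtain ⟨τ, hτ, h⟩ := exists_countable_survival_eq.{u, v, w} (σ.occupation_mem_flows s T)
  exact ⟨τ, hτ, funext fun n => (h n).trans (σ.survival_eq_sum_occupation s T n).symm⟩

end MDP

namespace MDP

variable {S : Type u} {Act : Type v} [Fintype S] {M : MDP S Act}

namespace Strategy

variable (σ : Strategy.{u, v, w} M)

/-! ### Strategies with a fixed finite memory set -/

/-- The strategy `σ` with its memory set replaced by `Q`: the map `d` decodes the new memory states,
and `e` encodes the old ones. -/
noncomputable def recode {Q : Type w} (d : Q → σ.Mem) (e : σ.Mem → Q) : Strategy.{u, v, w} M where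
  Mem := Q
  init := e σ.init
  choice s q := (σ.choice s (d q)).map fun p => (p.1, e p.2)
  enabled s q p hp := by
    obtain ⟨p', hp', rfl⟩ := (PMF.mem_support_map_iff _ _ _).1 hp
    exact σ.enabled _ _ _ hp'

theorem survival_recode {Q : Type w} (d : Q → σ.Mem) (e : σ.Mem → Q) (hde : ∀ m, d (e m) = m)
    (s : S) (T : Set S) : (σ.recode d e).survival s T = σ.survival s T := by
  have havoid (g : σ.Config → ℝ≥0∞) :
      (σ.recode d e).avoid T (fun c => g ⟨c.state, d c.mem⟩) =
        fun c => σ.avoid T g ⟨c.state, d c.mem⟩ := by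
    ext c
    refine (PMF.tsum_map_mul (σ.choice c.state (d c.mem)) (fun p => (p.1, e p.2)) fun p =>
      ∑ t, M.P c.state p.1 t * Tᶜ.indicator (fun t => g ⟨t, d p.2⟩) t).trans ?_
    simp only [hde]
    rfl
  have hiter (n : ℕ) : ∀ g : σ.Config → ℝ≥0∞,
      ((σ.recode d e).avoid T)^[n] (fun c => g ⟨c.state, d c.mem⟩) =
        fun c => (σ.avoid T)^[n] g ⟨c.state, d c.mem⟩ := by
    induction n with
    | zero => exact fun g => rfl
    | succ n ih =>
      intro g
      rw [Function.iterate_succ_apply, havoid, ih, Function.iterate_succ_apply]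
  ext n
  have h := congrFun (hiter n 1) ⟨s, (σ.recode d e).init⟩
  have hinit : d (σ.recode d e).init = σ.init := hde σ.init
  rw [hinit] at h
  by_cases hs : s ∈ T
  · simp [survival, expAvoid, hs]
  · simp only [survival, expAvoid, Set.mem_compl_iff, hs, not_false_eq_true, Set.indicator_of_mem]
    exact h

theorem avoid_iterate_le_one (T : Set S) (n : ℕ) (c : σ.Config) : (σ.avoid T)^[n] 1 c ≤ 1 := by
  induction n generalizing c with
  | zero => exact le_rfl
  | succ n ih =>
    rw [Function.iterate_succ_apply', avoid_eq_lintegral]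
    refine (lintegral_mono (g := fun _ => 1) fun d => ?_).trans (by simp)
    exact Set.indicator_apply_le' (fun _ => ih d) fun _ => zero_le_one

end Strategy

variable [Fintype Act]

variable (M) in
/-- The choice functions of the strategies with the finite memory set `Q`. -/
def choices (Q : Type w) [Fintype Q] : Set (S → Q → Act × Q → ℝ≥0∞) :=
  {f | (∀ s q, ∑ p, f s q p = 1) ∧ ∀ s q, ∀ p : Act × Q, p.1 ∉ M.En s → f s q p = 0}

variable {Q : Type w} [Fintype Q]

theorem isCompact_choices : IsCompact (M.choices Q) := by
  refine IsClosed.isCompact ?_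
  simp only [choices, Set.ofPred_and, Set.ofPred_forall]
  refine .inter ?_ ?_
  · exact isClosed_iInter fun s => isClosed_iInter fun q =>
      isClosed_eq (by fun_prop) continuous_const
  · exact isClosed_iInter fun s => isClosed_iInter fun q => isClosed_iInter fun p =>
      isClosed_iInter fun _ => isClosed_eq (by fun_prop) continuous_const

/-- The strategy with a given choice function and a given initial memory state. -/
noncomputable def Strategy.ofChoice (q₀ : Q) (f : M.choices Q) : Strategy.{u, v, w} M where
  Mem := Q
  init := q₀
  choice s q := PMF.ofFintype (f.1 s q) (f.2.1 s q)
  enabled s q p hp := by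
    rw [PMF.mem_support_ofFintype_iff] at hp
    by_contra h
    exact hp (f.2.2 s q p h)

theorem continuous_avoid_iterate (q₀ : Q) (T : Set S) (n : ℕ) (s : S) (q : Q) :
    Continuous fun f : M.choices Q =>
      ((Strategy.ofChoice q₀ f).avoid T)^[n] 1 (⟨s, q⟩ : (Strategy.ofChoice q₀ f).Config) := by
  induction n generalizing s q with
  | zero => exact continuous_const
  | succ n ih =>
    have h (f : M.choices Q) : ((Strategy.ofChoice q₀ f).avoid T)^[n + 1] 1
          (⟨s, q⟩ : (Strategy.ofChoice q₀ f).Config) =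
        ∑ p : Act × Q, f.1 s q p * ∑ t, M.P s p.1 t * Tᶜ.indicator (fun t =>
          ((Strategy.ofChoice q₀ f).avoid T)^[n] 1
            (⟨t, p.2⟩ : (Strategy.ofChoice q₀ f).Config)) t := by
      rw [Function.iterate_succ_apply', Strategy.avoid]
      exact tsum_fintype (L := .unconditional (Act × Q)) _
    have hle (f : M.choices Q) (t : S) (p : Act × Q) : Tᶜ.indicator (fun t =>
        ((Strategy.ofChoice q₀ f).avoid T)^[n] 1
          (⟨t, p.2⟩ : (Strategy.ofChoice q₀ f).Config)) t ≤ 1 :=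
      Set.indicator_apply_le' (fun _ => Strategy.avoid_iterate_le_one _ _ _ _) fun _ => zero_le_one
    simp_rw [h]
    refine continuous_finsetSum _ fun p _ => Continuous.ennreal_mul
      ((by fun_prop : Continuous fun x : S → Q → Act × Q → ℝ≥0∞ => x s q p).comp
        continuous_subtype_val) ?_
      (fun f => .inr ?_) fun f => .inr ?_
    · refine continuous_finsetSum _ fun t _ => ?_
      by_cases ht : t ∈ T
      · simpa [ht] using continuous_const
      · simp only [Set.mem_compl_iff, ht, not_false_eq_true, Set.indicator_of_mem]
        exact (ENNReal.continuous_const_mul ENNReal.coe_ne_top).comp (ih t p.2)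
    · exact ENNReal.sum_ne_top.2 fun t _ => ENNReal.mul_ne_top ENNReal.coe_ne_top
        (ne_top_of_le_ne_top ENNReal.one_ne_top (hle f t p))
    · exact ((Strategy.ofChoice q₀ f).choice s q).apply_ne_top p

theorem isCompact_survival_ofChoice (s : S) (T : Set S) :
    IsCompact ((fun σ : Strategy.{u, v, w} M => σ.survival s T) ''
      ⋃ q₀ : Q, Set.range (Strategy.ofChoice q₀)) := by
  rw [Set.image_iUnion]
  refine isCompact_iUnion fun q₀ => ?_
  have : CompactSpace (M.choices Q) := isCompact_iff_compactSpace.1 isCompact_choices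
  rw [← Set.range_comp]
  refine isCompact_range (continuous_pi fun n => ?_)
  by_cases hs : s ∈ T
  · simpa [Function.comp_def, Strategy.survival, Strategy.expAvoid, hs] using continuous_const
  · simp only [Function.comp_def, Strategy.survival, Strategy.expAvoid, Set.mem_compl_iff, hs,
      not_false_eq_true, Set.indicator_of_mem]
    exact continuous_avoid_iterate q₀ T n s q₀

/-- A strategy with at most `n` memory states can be transferred to every memory set with `n`
elements. -/
theorem Strategy.exists_ofChoice (σ : Strategy.{u, v, w} M) (hσ : ENat.card σ.Mem ≤ Fintype.card Q)
    (s : S) (T : Set S) :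
    ∃ (q₀ : Q) (f : M.choices Q), (Strategy.ofChoice q₀ f).survival s T = σ.survival s T := by
  have : Nonempty σ.Mem := ⟨σ.init⟩
  have : Finite σ.Mem := ENat.card_lt_top.1 (hσ.trans_lt (ENat.natCast_lt_top _))
  have := Fintype.ofFinite σ.Mem
  rw [ENat.card_eq_coe_fintype_card, Nat.cast_le] at hσ
  obtain ⟨e⟩ := Function.Embedding.nonempty_of_card_le hσ
  let τ := σ.recode (Function.invFun e) e
  refine ⟨e σ.init, ⟨fun s q => τ.choice s q, fun s q => ?_, fun s q p hp => ?_⟩, ?_⟩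
  · exact (tsum_fintype (L := .unconditional _) _).symm.trans (τ.choice s q).tsum_coe
  · by_contra hne
    exact hp (τ.enabled s q p ((PMF.mem_support_iff _ _).2 hne))
  · exact σ.survival_recode _ e (Function.leftInverse_invFun e.injective) s T

end MDP

/-! ### Existence of optimal profiles -/

theorem mainTheorem4 {S : Type u} {Act : Type v} [Fintype S] [Fintype Act] (I : MSSP S Act) :
    (∃ π : MSSP.Profile.{u, v, w} I, (∀ i, Countable (π i).Mem) ∧ MSSP.IsOptimal π) ∧
      ∀ n : ℕ, 1 ≤ n → ∃ π : MSSP.Profile.{u, v, w} I, MSSP.IsMemOptimal n π := by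
  choose a ha using I.M.exists_enabled
  -- A strategy with a single memory state witnesses that both classes are nonempty.
  let σ₀ : MDP.Strategy.{u, v, w} I.M :=
    { Mem := PUnit, init := ⟨⟩, choice := fun s m => PMF.pure (a s, m),
      enabled := fun s m p hp => by
        rw [PMF.mem_support_pure_iff] at hp
        exact hp ▸ ha s }
  have hσ₀ : ENat.card σ₀.Mem = 1 := by
    rw [show σ₀.Mem = PUnit.{w + 1} from rfl, ENat.card_eq_coe_fintype_card, Fintype.card_punit,
      Nat.cast_one]
  constructor
  · obtain ⟨π, hπ, hmin⟩ := MSSP.exists_expMHit_minimal (I := I)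
      (fun _ => {σ : MDP.Strategy.{u, v, w} I.M | Countable σ.Mem})
      (fun i => ⟨σ₀, inferInstanceAs (Countable PUnit)⟩)
      fun i => MDP.isCompact_survival_countable _ _
    refine ⟨π, hπ, le_antisymm (le_iInf fun π' => ?_) (iInf_le _ π)⟩
    choose τ hτ hsurv using fun i => (π' i).exists_countable (I.init i) (I.target i)
    refine (hmin τ hτ).trans_eq ?_
    simp_rw [MSSP.expMHit_eq_tsum, hsurv]
  · intro n hn
    let Q := ULift.{w} (Fin n)
    have hQ : (Fintype.card Q : ℕ∞) = n := by simp [Q]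
    have hne (i) : ∃ (q₀ : Q) (f : I.M.choices Q), (MDP.Strategy.ofChoice q₀ f).survival
        (I.init i) (I.target i) = σ₀.survival (I.init i) (I.target i) :=
      σ₀.exists_ofChoice (by rw [hσ₀, hQ]; exact_mod_cast hn) _ _
    obtain ⟨π, hπ, hmin⟩ := MSSP.exists_expMHit_minimal (I := I)
      (fun _ => ⋃ q₀ : Q, Set.range (MDP.Strategy.ofChoice (M := I.M) q₀))
      (fun i => by
        obtain ⟨q₀, f, -⟩ := hne i
        exact ⟨_, Set.mem_iUnion.2 ⟨q₀, f, rfl⟩⟩)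
      fun i => MDP.isCompact_survival_ofChoice _ _
    have hmem : π ∈ MSSP.memBounded.{u, v, w} I n := fun i => by
      obtain ⟨q₀, f, hf⟩ := Set.mem_iUnion.1 (hπ i)
      rw [← hf, ← hQ, ← ENat.card_eq_coe_fintype_card]
      exact le_rfl
    refine ⟨π, hmem, le_antisymm (le_iInf₂ fun π' hπ' => ?_) (iInf₂_le π hmem)⟩
    choose q₀ f hsurv using fun i => (π' i).exists_ofChoice (Q := Q) (by rw [hQ]; exact hπ' i)
      (I.init i) (I.target i)
    refine (hmin (fun i => MDP.Strategy.ofChoice (q₀ i) (f i)) fun i =>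
      Set.mem_iUnion.2 ⟨q₀ i, f i, rfl⟩).trans_eq ?_
    simp_rw [MSSP.expMHit_eq_tsum, hsurv]
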